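/- For an integer $n\ge 0$ let $\mathfrak B_n$ be the affine scheme over $\mathbb Z$ that parametrizes based rank-$n$ algebras: the closed subscheme of $\mathbb A^{n^3+n}_{\mathbb Z}$ with coordinates $c_{ij}^\ell, d_i$ $(1\le i,j,\ell\le n)$ cut out by the polynomial equations which say that the multiplication $e_ie_j=\sum_\ell c_{ij}^\ell e_\ell$ on the free module with basis $e_1,\dots,e_n$ is commutative and associative and has $\sum_i d_ie_i$ as identity element. For a field $k$ let $\mathfrak B_{n,k}=\mathfrak B_n\times_{\operatorname{Spec}\mathbb Z}\operatorname{Spec}k$, and let $\mathfrak B_{n,k}^{\mathrm{et}}\subseteq\mathfrak B_{n,k}$ be the étale locus, that is, the open subscheme where the discriminant $\Delta=\det(\operatorname{Tr}(e_ie_j))$ is invertible. A $k$-algebra of rank $n$ together with a $k$-basis determines a $k$-point of $\mathfrak B_{n,k}$. **Proposition.** Let $k$ be a field and let $n\ge 8$. Then $\mathfrak B_{n,k}$ is reducible (nonempty and not irreducible). More precisely, the $k$-algebra $$A=\frac{k[a,b,c,d]}{(a^2,\,ab,\,b^2,\,c^2,\,cd,\,d^2,\,ad-bc)}$$ has rank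 $8$, so that $A\times k^{n-8}$ has rank $n$, and $A\times k^{n-8}$ is not a degeneration of étale algebras: for every choice of a $k$-basis of $A\times k^{n-8}$, the corresponding point of $\mathfrak B_{n,k}$ does not lie in the Zariski closure of $\mathfrak B_{n,k}^{\mathrm{et}}$. -/

import Mathlib

open AlgebraicGeometry TensorProduct

universe u

noncomputable section

namespace BasedAlg

/-- The coordinates on affine space of dimension `n ^ 3 + n`: the structure constants
`c i j l` (indexed by `Sum.inl (i, j, l)`) and the coordinates `d i` of the identity element
(indexed by `Sum.inr i`). -/
abbrev Idx (n : ℕ) : Type := (Fin n × Fin n × Fin n) ⊕ Fin n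

/-- The indeterminate `c i j l`, the coefficient of `e l` in `e i * e j`. -/
def c {n : ℕ} (i j l : Fin n) : MvPolynomial (Idx n) ℤ := MvPolynomial.X (Sum.inl (i, j, l))

/-- The indeterminate `d i`, the coefficient of `e i` in the identity element. -/
def d {n : ℕ} (i : Fin n) : MvPolynomial (Idx n) ℤ := MvPolynomial.X (Sum.inr i)

/-- `e i * e j = e j * e i`, coefficient of `e l`. -/
def commRel {n : ℕ} (i j l : Fin n) : MvPolynomial (Idx n) ℤ := c i j l - c j i l

/-- `(e i * e j) * e l = e i * (e j * e l)`, coefficient of `e p`. -/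
def assocRel {n : ℕ} (i j l p : Fin n) : MvPolynomial (Idx n) ℤ :=
  ∑ m, c i j m * c m l p - ∑ m, c j l m * c i m p

/-- `(∑ i, d i • e i) * e j = e j`, coefficient of `e l`. -/
def unitRel {n : ℕ} (j l : Fin n) : MvPolynomial (Idx n) ℤ :=
  ∑ i, d i * c i j l - if j = l then 1 else 0

/-- The ideal of the conditions that the multiplication law is commutative and associative and
has `∑ i, d i • e i` as identity. -/
def relIdeal (n : ℕ) : Ideal (MvPolynomial (Idx n) ℤ) :=
  Ideal.span ({f | ∃ i j l, f = commRel i j l} ∪ {f | ∃ i j l p, f = assocRel i j l p} ∪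
    {f | ∃ j l, f = unitRel j l})

/-- The coordinate ring of the moduli scheme `𝔅 n` of based rank-`n` (commutative, associative,
unital) algebras, an affine scheme over `ℤ`. -/
abbrev CoordRing (n : ℕ) : Type := MvPolynomial (Idx n) ℤ ⧸ relIdeal n

/-- The coordinate ring of the base change to `k`. -/
abbrev CoordRingOver (n : ℕ) (k : Type u) [Field k] : Type u := k ⊗[ℤ] CoordRing n

/-- The base change `𝔅 n ×_{Spec ℤ} Spec k` of `𝔅 n = Spec (CoordRing n)` to a field `k`: a fibre product
of affine schemes is the spectrum of the tensor product. -/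
def 𝔅Over (n : ℕ) (k : Type u) [Field k] : Scheme.{u} := Spec (.of (CoordRingOver n k))

/-- The trace of multiplication by `e l` on the universal based algebra. -/
def universalTrace {n : ℕ} (l : Fin n) : MvPolynomial (Idx n) ℤ := ∑ m, c l m m

/-- The discriminant `Δ = det (Tr (e i * e j))` of the universal based algebra, as a regular
function on `𝔅 n`. -/
def Δ (n : ℕ) : CoordRing n :=
  Ideal.Quotient.mk (relIdeal n)
    (Matrix.det (Matrix.of fun i j : Fin n => ∑ l, c i j l * universalTrace l))

/-- The étale locus of `𝔅Over n k`: the open subscheme where the discriminant is invertible. -/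
def etaleLocus (n : ℕ) (k : Type u) [Field k] : (𝔅Over n k).Opens :=
  PrimeSpectrum.basicOpen ((1 : k) ⊗ₜ[ℤ] Δ n)

section Point

variable {n : ℕ} {R : Type*} [CommRing R] {A : Type*} [CommRing A] [Algebra R A]

/-- The values of the coordinates at the algebra `A` with basis `b`. -/
def coords (b : Module.Basis (Fin n) R A) : Idx n → R
  | Sum.inl (i, j, l) => b.repr (b i * b j) l
  | Sum.inr i => b.repr 1 i

theorem coords_rel (b : Module.Basis (Fin n) R A) (f : MvPolynomial (Idx n) ℤ)
    (hf : f ∈ relIdeal n) : MvPolynomial.aeval (coords b) f = 0 := by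
  have key : ∀ x y : A, ∀ p, b.repr (x * y) p = ∑ m, b.repr x m * b.repr (b m * y) p := by
    intro x y p
    have h : x * y = ∑ m, b.repr x m • (b m * y) := by
      conv_lhs => rw [← b.sum_repr x, Finset.sum_mul]
      simp
    rw [h]
    simp
  suffices h : relIdeal n ≤ RingHom.ker (MvPolynomial.aeval (R := ℤ) (coords b)) from h hf
  refine Ideal.span_le.2 ?_
  rintro f ((⟨i, j, l, rfl⟩ | ⟨i, j, l, p, rfl⟩) | ⟨j, l, rfl⟩)
  · simp [commRel, c, coords, mul_comm]
  · have h1 := key (b i * b j) (b l) p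
    have h2 : ∑ m, b.repr (b j * b l) m * b.repr (b i * b m) p = b.repr (b j * b l * b i) p := by
      rw [key]
      exact Finset.sum_congr rfl fun m _ => by rw [mul_comm (b i)]
    simp only [SetLike.mem_coe, RingHom.mem_ker, assocRel, c, map_sub, map_sum, map_mul,
      MvPolynomial.aeval_X, coords]
    rw [← h1, h2, sub_eq_zero]
    congr 2
    ring
  · have h1 := key 1 (b j) l
    rw [one_mul] at h1
    simp only [SetLike.mem_coe, RingHom.mem_ker, unitRel, c, d, map_sub, map_sum, map_mul,
      MvPolynomial.aeval_X, coords]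
    rw [← h1]
    split_ifs with h
    · simp [h]
    · simp [h]

/-- Evaluation of functions on `𝔅 n` at the algebra `A` with basis `b`. -/
def evalAt (b : Module.Basis (Fin n) R A) : CoordRing n →ₐ[ℤ] R :=
  Ideal.Quotient.liftₐ (relIdeal n) (MvPolynomial.aeval (coords b)) (coords_rel b)

end Point

/-- Evaluation of functions on `𝔅Over n k` at the `k`-algebra `A` with basis `b`. -/
def evalOver {n : ℕ} {k : Type u} [Field k] {A : Type*} [CommRing A] [Algebra k A]
    (b : Module.Basis (Fin n) k A) : CoordRingOver n k →ₐ[k] k :=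
  Algebra.TensorProduct.lift (Algebra.ofId k k) (evalAt b) fun _ _ => mul_comm _ _

/-- The `k`-rational section `Spec k ⟶ 𝔅Over n k` given by the `k`-algebra `A` with basis `b`. -/
def pointHom {n : ℕ} {k : Type u} [Field k] {A : Type*} [CommRing A] [Algebra k A]
    (b : Module.Basis (Fin n) k A) : Spec (.of k) ⟶ 𝔅Over n k :=
  Spec.map (CommRingCat.ofHom (evalOver b).toRingHom)

/-- The point of `𝔅Over n k` given by the `k`-algebra `A` with basis `b`. -/
def point {n : ℕ} {k : Type u} [Field k] {A : Type*} [CommRing A] [Algebra k A]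
    (b : Module.Basis (Fin n) k A) : 𝔅Over n k :=
  pointHom b (IsLocalRing.closedPoint k)

open MvPolynomial in
/-- The ideal `(a², ab, b², c², cd, d², ad - bc)` of `k[a, b, c, d]`, where
`a = X 0`, `b = X 1`, `c = X 2`, `d = X 3`. -/
def witnessIdeal (k : Type u) [Field k] : Ideal (MvPolynomial (Fin 4) k) :=
  Ideal.span {X 0 ^ 2, X 0 * X 1, X 1 ^ 2, X 2 ^ 2, X 2 * X 3, X 3 ^ 2, X 0 * X 3 - X 1 * X 2}

/-- The algebra `k[a, b, c, d] / (a², ab, b², c², cd, d², ad - bc)`. -/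
abbrev Witness (k : Type u) [Field k] : Type u := MvPolynomial (Fin 4) k ⧸ witnessIdeal k

end BasedAlg

end

/-! The invariant is the dimension of the space of symmetric Hochschild 2-cocycles of an algebra
with values in itself. These are the first-order deformations of the multiplication, so this is a
tangent space dimension on the moduli scheme; the proof only uses linear algebra.

In a basis, the cocycles are the kernel of a matrix whose entries are regular functions on the
moduli scheme. Hence the condition "fewer than `n ^ 2` cocycles" at a rational point spreads to an
open neighbourhood (`exists_finrank_ker_lt`). At every point with invertible discriminant, of
whatever residue field, there are at least `n ^ 2` cocycles: the coboundary map on endomorphisms is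
injective because a nondegenerate trace form forbids nonzero derivations (`sq_le_finrank_cocycles`).
So an algebra with fewer than `n ^ 2` cocycles is not in the closure of the étale locus
(`point_notMem_closure`). That locus is open and contains the split algebra, so it would be dense in
an irreducible space; reducibility follows.

It remains to bound the cocycles of the witness times `k ^ m`, where `n = 8 + m`. The witness is
graded with dimensions 1, 4, 3. Idempotents reduce a cocycle to its local part up to few parameters,
and the syzygies among the quadratic relations control the local part (`cocycle_apply_eq_zero`). A
cocycle is determined by `m ^ 2 + 16 * m + 58` scalars, six fewer than `(8 + m) ^ 2`. The argument
is independent of the characteristic. -/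

namespace BasedAlg

/-! ### Semicontinuity of kernel dimension -/

theorem map_det_mul_add_mul {S κ U E F : Type*} [CommRing S] [CommRing κ] [Fintype U]
    [DecidableEq U] [Fintype E] [Fintype F] (q : S →+* κ) (A : Matrix U E S) (B : Matrix E U S)
    (C : Matrix U F S) (D : Matrix F U S) :
    q (A * B + C * D).det = (A.map q * B.map q + C.map q * D.map q).det := by
  rw [RingHom.map_det, map_add, RingHom.mapMatrix_apply, RingHom.mapMatrix_apply, Matrix.map_mul,
    Matrix.map_mul]

/-- A vector killed by both `B` and `D` is killed by the invertible matrix `A * B + C * D`, so `D`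
embeds the kernel of `B` in an `r`-dimensional space. -/
theorem finrank_ker_le_of_det_ne_zero {κ U E : Type*} [Field κ] [Fintype U]
    [DecidableEq U] [Fintype E] (r : ℕ) (A : Matrix U E κ) (B : Matrix E U κ)
    (C : Matrix U (Fin r) κ) (D : Matrix (Fin r) U κ) (h : (A * B + C * D).det ≠ 0) :
    Module.finrank κ (LinearMap.ker B.mulVecLin) ≤ r := by
  have hinj : Function.Injective (D.mulVecLin ∘ₗ (LinearMap.ker B.mulVecLin).subtype) := by
    refine (injective_iff_map_eq_zero _).2 fun v hv => ?_
    have hB : B.mulVec v.1 = 0 := v.2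
    have hD : D.mulVec v.1 = 0 := hv
    refine Subtype.ext (Matrix.eq_zero_of_mulVec_eq_zero h ?_)
    rw [Matrix.add_mulVec, ← Matrix.mulVec_mulVec, ← Matrix.mulVec_mulVec, hB, hD]
    simp
  simpa using LinearMap.finrank_le_finrank_of_injective hinj

/-- If the kernel of a specialization of a matrix over a `k`-algebra has dimension less than `N`,
then so have the kernels of the specializations in an open neighbourhood. -/
theorem exists_finrank_ker_lt {k S E U : Type*} [Field k] [CommRing S] [Algebra k S]
    [Fintype E] [DecidableEq E] [Fintype U] [DecidableEq U] (M : Matrix E U S) (p : S →ₐ[k] k)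
    (N : ℕ) (h : Module.finrank k (LinearMap.ker (M.map p).mulVecLin) < N) :
    ∃ f : S, p f = 1 ∧ ∀ {κ : Type u} [Field κ] (q : S →+* κ), q f ≠ 0 →
      Module.finrank κ (LinearMap.ker (M.map q).mulVecLin) < N := by
  set K := LinearMap.ker (M.map p).mulVecLin with hK
  -- A projection onto the kernel, written in coordinates, supplies exactly the extra rows that make
  -- the specialized matrix injective.
  obtain ⟨D, hD⟩ := K.subtype.exists_leftInverse_of_injective K.ker_subtype
  let B := Module.finBasis k K
  let D' : (U → k) →ₗ[k] (Fin (Module.finrank k K) → k) := B.equivFun.toLinearMap ∘ₗ D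
  have hinj : LinearMap.ker ((M.map p).mulVecLin.prod D') = ⊥ := by
    refine (Submodule.eq_bot_iff _).2 fun v hv => ?_
    simp only [LinearMap.ker_prod, Submodule.mem_inf] at hv
    have h1 := LinearMap.congr_fun hD ⟨v, hv.1⟩
    have h2 : D v = 0 := by simpa [D'] using hv.2
    simp only [LinearMap.comp_apply, Submodule.subtype_apply, h2, LinearMap.id_apply] at h1
    exact (congrArg Subtype.val h1).symm
  obtain ⟨L, hL⟩ := ((M.map p).mulVecLin.prod D').exists_leftInverse_of_injective hinj
  let L₁ := LinearMap.toMatrix' (L ∘ₗ LinearMap.inl k _ _)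
  let L₂ := LinearMap.toMatrix' (L ∘ₗ LinearMap.inr k _ _)
  let P := LinearMap.toMatrix' D'
  have hone : L₁ * M.map p + L₂ * P = 1 := by
    apply Matrix.toLin'.injective
    rw [map_add, Matrix.toLin'_mul, Matrix.toLin'_mul, Matrix.toLin'_one]
    simp only [L₁, L₂, P, Matrix.toLin'_toMatrix']
    rw [← hL]
    refine LinearMap.ext fun v => ?_
    simp only [LinearMap.comp_apply, LinearMap.add_apply, LinearMap.prod_apply,
      LinearMap.inl_apply, LinearMap.inr_apply, ← map_add]
    simp [Matrix.toLin'_apply']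
  -- The left inverse at `p` has entries in `k`, so it lifts to `S`. The resulting determinant is 1
  -- at `p`, and its nonvanishing at `q` bounds the kernel by the number of added rows.
  refine ⟨(L₁.map (algebraMap k S) * M + L₂.map (algebraMap k S) * P.map (algebraMap k S)).det,
    ?_, fun {κ} _ q hq => ?_⟩
  · have := map_det_mul_add_mul p.toRingHom (L₁.map (algebraMap k S)) M
      (L₂.map (algebraMap k S)) (P.map (algebraMap k S))
    have hid : (p.toRingHom : S → k) ∘ algebraMap k S = id := by ext x; simp
    simp only [Matrix.map_map, hid, Matrix.map_id] at this
    exact this.trans ((congrArg Matrix.det hone).trans Matrix.det_one)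
  · refine lt_of_le_of_lt ?_ h
    rw [map_det_mul_add_mul] at hq
    exact finrank_ker_le_of_det_ne_zero _ _ _ _ _ hq

/-! ### Symmetric Hochschild cocycles and coboundaries -/

section Cocycles

variable (R C : Type*) [CommRing R] [CommRing C] [Algebra R C]

/-- The symmetric Hochschild 2-cocycles of `C` with values in `C`. -/
def cocycles : Submodule R (C →ₗ[R] C →ₗ[R] C) where
  carrier := {φ | (∀ x y, φ x y = φ y x) ∧
    ∀ x y z, x * φ y z - φ (x * y) z + φ x (y * z) - z * φ x y = 0}
  add_mem' := by
    rintro φ ψ ⟨h1, h2⟩ ⟨h3, h4⟩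
    refine ⟨fun x y => by simp [h1 x y, h3 x y], fun x y z => ?_⟩
    simp only [LinearMap.add_apply]
    linear_combination h2 x y z + h4 x y z
  zero_mem' := by simp
  smul_mem' := by
    rintro r φ ⟨h1, h2⟩
    refine ⟨fun x y => by simp [h1 x y], fun x y z => ?_⟩
    simp only [LinearMap.smul_apply, mul_smul_comm, ← smul_add, ← smul_sub, h2, smul_zero]

/-- The Hochschild coboundary of an endomorphism. -/
def coboundary : (C →ₗ[R] C) →ₗ[R] C →ₗ[R] C →ₗ[R] C where
  toFun g := (LinearMap.mul R C).compl₂ g - (LinearMap.mul R C).compr₂ g +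
    ((LinearMap.mul R C).compl₂ g).flip
  map_add' g h := by
    ext x y
    simp [mul_add]
    ring
  map_smul' r g := by
    ext x y
    simp [smul_sub, smul_add]

variable {R C}

theorem coboundary_apply (g : C →ₗ[R] C) (x y : C) :
    coboundary R C g x y = x * g y - g (x * y) + y * g x := by
  simp [coboundary]

theorem coboundary_mem_cocycles (g : C →ₗ[R] C) : coboundary R C g ∈ cocycles R C := by
  refine ⟨fun x y => ?_, fun x y z => ?_⟩
  · simp only [coboundary_apply, mul_comm y x]
    ring
  · simp only [coboundary_apply, mul_assoc]
    ring

end Cocycles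

/-! ### Étale algebras have many cocycles -/

section Etale

variable {κ C ι : Type*} [Field κ] [CommRing C] [Algebra κ C] [Fintype ι] [DecidableEq ι]

theorem repr_eq_trace_mul_dualBasis (b : Module.Basis ι κ C)
    (h : (Algebra.traceForm κ C).Nondegenerate) (y : C) (j : ι) :
    b.repr y j = Algebra.trace κ C (y * (Algebra.traceForm κ C).dualBasis h b j) := by
  conv_rhs => rw [← b.sum_repr y, Finset.sum_mul, map_sum]
  have hs : (Algebra.traceForm κ C).IsSymm := Algebra.traceForm_isSymm κ
  simp only [smul_mul_assoc, map_smul, ← Algebra.traceForm_apply κ,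
    LinearMap.BilinForm.apply_dualBasis_right h hs]
  simp

/-- Paired with `y`, the sum gives the diagonal entries of multiplication by `y`, hence the trace of
`y`; nondegeneracy then identifies it with 1. -/
theorem sum_mul_dualBasis (b : Module.Basis ι κ C)
    (h : (Algebra.traceForm κ C).Nondegenerate) :
    ∑ i, b i * (Algebra.traceForm κ C).dualBasis h b i = 1 := by
  rw [← sub_eq_zero]
  refine h.1 _ fun y => ?_
  rw [Algebra.traceForm_apply, sub_mul, map_sub, sub_eq_zero, one_mul, Finset.sum_mul, map_sum,
    Algebra.trace_eq_matrix_trace b, Matrix.trace]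
  refine Finset.sum_congr rfl fun i _ => ?_
  rw [Matrix.diag_apply, Algebra.leftMulMatrix_eq_repr_mul, repr_eq_trace_mul_dualBasis b h]
  congr 1
  ring

/-- This is `(x ⊗ 1) e = (1 ⊗ x) e` for the separability element `e = ∑ bᵢ ⊗ bᵢ*`, after applying
`g` to the left factor and multiplying. -/
theorem sum_map_mul_mul_dualBasis (b : Module.Basis ι κ C)
    (h : (Algebra.traceForm κ C).Nondegenerate) (g : C →ₗ[κ] C) (x : C) :
    ∑ i, g (x * b i) * (Algebra.traceForm κ C).dualBasis h b i =
      ∑ i, g (b i) * (x * (Algebra.traceForm κ C).dualBasis h b i) := by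
  set b' := (Algebra.traceForm κ C).dualBasis h b with hb'
  have h1 : ∀ i, g (x * b i) * b' i =
      ∑ j, Algebra.trace κ C (x * b i * b' j) • (g (b j) * b' i) := fun i => by
    conv_lhs => rw [← b.sum_repr (x * b i), map_sum, Finset.sum_mul]
    simp [repr_eq_trace_mul_dualBasis b h, hb']
  have h2 : ∀ j, g (b j) * (x * b' j) =
      ∑ i, Algebra.trace κ C (x * b i * b' j) • (g (b j) * b' i) := fun j => by
    conv_lhs => rw [← b'.sum_repr (x * b' j), Finset.mul_sum]
    refine Finset.sum_congr rfl fun i _ => ?_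
    rw [hb', LinearMap.BilinForm.dualBasis_repr_apply, Algebra.traceForm_apply, mul_smul_comm,
      mul_right_comm]
  simp only [h1, h2]
  exact Finset.sum_comm

/-- An algebra with nondegenerate trace form has no nonzero derivations. -/
theorem eq_zero_of_coboundary_eq_zero (b : Module.Basis ι κ C)
    (h : (Algebra.traceForm κ C).Nondegenerate) (g : C →ₗ[κ] C)
    (hg : coboundary κ C g = 0) : g = 0 := by
  have hd : ∀ x y, g (x * y) = x * g y + y * g x := fun x y => by
    have := LinearMap.congr_fun₂ hg x y
    rw [coboundary_apply, LinearMap.zero_apply, LinearMap.zero_apply] at this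
    linear_combination -this
  refine LinearMap.ext fun x => ?_
  -- By the Leibniz rule the left side is `g x * ∑ bᵢ bᵢ* = g x` plus a copy of the right side.
  have h1 := sum_map_mul_mul_dualBasis b h g x
  simp only [hd, add_mul, Finset.sum_add_distrib] at h1
  have h2 : ∑ i, b i * g x * (Algebra.traceForm κ C).dualBasis h b i = g x := by
    trans g x * ∑ i, b i * (Algebra.traceForm κ C).dualBasis h b i
    · rw [Finset.mul_sum]
      exact Finset.sum_congr rfl fun i _ => by ring
    · rw [sum_mul_dualBasis, mul_one]
  have h3 : ∑ i, x * g (b i) * (Algebra.traceForm κ C).dualBasis h b i =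
      ∑ i, g (b i) * (x * (Algebra.traceForm κ C).dualBasis h b i) :=
    Finset.sum_congr rfl fun i _ => by ring
  rw [h2, h3] at h1
  simpa using h1

theorem sq_le_finrank_cocycles (b : Module.Basis ι κ C) (hb : Algebra.discr κ b ≠ 0) :
    Fintype.card ι ^ 2 ≤ Module.finrank κ (cocycles κ C) := by
  have := Module.Finite.of_basis b
  have h : (Algebra.traceForm κ C).Nondegenerate := by
    rwa [LinearMap.BilinForm.nondegenerate_iff_det_ne_zero b, ← Algebra.traceMatrix_of_basis]
  have hinj : Function.Injective
      ((coboundary κ C).codRestrict (cocycles κ C) coboundary_mem_cocycles) :=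
    (injective_iff_map_eq_zero _).2 fun g hg =>
      eq_zero_of_coboundary_eq_zero b h g (congrArg Subtype.val hg)
  have := LinearMap.finrank_le_finrank_of_injective hinj
  rwa [Module.finrank_linearMap, Module.finrank_eq_card_basis b, ← sq] at this

end Etale

/-! ### Cocycles as the kernel of a matrix of structure constants -/

section Coordinates

variable {n : ℕ} {S : Type*} [CommRing S]

/-- The linear equations for a cocycle in terms of its coordinates, for the algebra with
structure constants `s`. -/
def cocycleMap (s : Fin n → Fin n → Fin n → S) : (Fin n × Fin n × Fin n → S) →ₗ[S]
    ((Fin n × Fin n × Fin n) ⊕ (Fin n × Fin n × Fin n × Fin n) → S) where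
  toFun v := Sum.elim (fun t => v (t.1, t.2.1, t.2.2) - v (t.2.1, t.1, t.2.2))
    fun t => ∑ m, v (t.2.1, t.2.2.1, m) * s t.1 m t.2.2.2 -
      ∑ m, s t.1 t.2.1 m * v (m, t.2.2.1, t.2.2.2) +
      ∑ m, s t.2.1 t.2.2.1 m * v (t.1, m, t.2.2.2) -
      ∑ m, v (t.1, t.2.1, m) * s t.2.2.1 m t.2.2.2
  map_add' v w := by
    ext (t | t)
    · simp only [Sum.elim_inl, Pi.add_apply]
      ring
    · simp only [Sum.elim_inr, Pi.add_apply, mul_add, add_mul, Finset.sum_add_distrib]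
      ring
  map_smul' r v := by
    ext (t | t)
    · simp [mul_sub]
    · simp only [Sum.elim_inr, Pi.smul_apply, smul_eq_mul, mul_left_comm _ r, mul_assoc r,
        ← Finset.mul_sum, RingHom.id_apply]
      ring

theorem map_toMatrix'_cocycleMap {κ : Type*} [CommRing κ] (q : S →+* κ)
    (s : Fin n → Fin n → Fin n → S) :
    (LinearMap.toMatrix' (cocycleMap s)).map q =
      LinearMap.toMatrix' (cocycleMap fun i j l => q (s i j l)) := by
  ext t w
  have h : ∀ x, q (Pi.single (M := fun _ => S) w 1 x) = Pi.single (M := fun _ => κ) w 1 x := by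
    intro x
    rw [Pi.single_apply, Pi.single_apply]
    split_ifs <;> simp
  rcases t with t | t <;>
    simp [LinearMap.toMatrix'_apply, cocycleMap, h]

variable {C : Type*} [CommRing C] [Algebra S C]

/-- The coordinates of bilinear maps. -/
noncomputable def bilinEquiv (b : Module.Basis (Fin n) S C) :
    (C →ₗ[S] C →ₗ[S] C) ≃ₗ[S] (Fin n × Fin n × Fin n → S) :=
  (b.constr S).symm ≪≫ₗ LinearEquiv.piCongrRight (fun _ => (b.constr S).symm ≪≫ₗ
    LinearEquiv.piCongrRight fun _ => b.equivFun) ≪≫ₗ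
    LinearEquiv.piCongrRight (fun _ => (LinearEquiv.curry S S (Fin n) (Fin n)).symm) ≪≫ₗ
    (LinearEquiv.curry S S (Fin n) (Fin n × Fin n)).symm

theorem bilinEquiv_apply (b : Module.Basis (Fin n) S C) (φ : C →ₗ[S] C →ₗ[S] C) (i j l : Fin n) :
    bilinEquiv b φ (i, j, l) = b.repr (φ (b i) (b j)) l := by
  simp [bilinEquiv, Module.Basis.constr]

theorem repr_mul_apply (b : Module.Basis (Fin n) S C) (x y : C) (p : Fin n) :
    b.repr (x * y) p = ∑ m, b.repr y m * b.repr (x * b m) p := by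
  have h : x * y = ∑ m, b.repr y m • (x * b m) := by
    conv_lhs => rw [← b.sum_repr y, Finset.mul_sum]
    simp
  rw [h]
  simp

theorem repr_map_apply (b : Module.Basis (Fin n) S C) (f : C →ₗ[S] C) (y : C) (p : Fin n) :
    b.repr (f y) p = ∑ m, b.repr y m * b.repr (f (b m)) p := by
  conv_lhs => rw [← b.sum_repr y, map_sum, map_sum]
  simp only [Finsupp.coe_finsetSum, Finset.sum_apply, map_smul, Finsupp.smul_apply, smul_eq_mul]

/-- Symmetry and the cocycle identity are multilinear, so testing them on basis vectors suffices. -/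
theorem mem_cocycles_iff (b : Module.Basis (Fin n) S C) (φ : C →ₗ[S] C →ₗ[S] C) :
    φ ∈ cocycles S C ↔ cocycleMap (fun i j l => b.repr (b i * b j) l) (bilinEquiv b φ) = 0 := by
  have e1 : ∀ i j l, bilinEquiv b φ (i, j, l) = b.repr (φ (b i) (b j)) l := bilinEquiv_apply b φ
  have e2 : ∀ i j l p, cocycleMap (fun i j l => b.repr (b i * b j) l) (bilinEquiv b φ)
      (Sum.inr (i, j, l, p)) = b.repr (b i * φ (b j) (b l) - φ (b i * b j) (b l) +
        φ (b i) (b j * b l) - b l * φ (b i) (b j)) p := fun i j l p => by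
    have := repr_map_apply b (φ.flip (b l)) (b i * b j) p
    simp only [LinearMap.flip_apply] at this
    rw [map_sub, map_add, map_sub, Finsupp.sub_apply, Finsupp.add_apply, Finsupp.sub_apply, this,
      repr_mul_apply b (b i), repr_mul_apply b (b l), repr_map_apply b (φ (b i)) (b j * b l)]
    simp [cocycleMap, e1]
  have e3 : ∀ i j l, cocycleMap (fun i j l => b.repr (b i * b j) l) (bilinEquiv b φ)
      (Sum.inl (i, j, l)) = b.repr (φ (b i) (b j) - φ (b j) (b i)) l := fun i j l => by
    simp [cocycleMap, e1]
  constructor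
  · rintro ⟨h1, h2⟩
    ext (⟨i, j, l⟩ | ⟨i, j, l, p⟩)
    · rw [e3, h1, sub_self, map_zero]
      rfl
    · rw [e2, h2, map_zero]
      rfl
  · intro h
    have h1 : φ = φ.flip := by
      refine b.ext fun i => b.ext fun j => b.repr.injective (Finsupp.ext fun l => ?_)
      rw [LinearMap.flip_apply, ← sub_eq_zero, ← Finsupp.sub_apply, ← map_sub, ← e3, h]
      rfl
    refine ⟨fun x y => LinearMap.congr_fun₂ h1 x y, ?_⟩
    -- The defect of the cocycle identity, packaged as a trilinear map so that extensionality on the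
    -- basis applies.
    let T : C →ₗ[S] C →ₗ[S] C →ₗ[S] C := LinearMap.mk₂ S
      (fun x y => LinearMap.mulLeft S x ∘ₗ φ y - φ (x * y) + φ x ∘ₗ LinearMap.mulLeft S y -
        LinearMap.mulRight S (φ x y))
      (fun x x' y => by ext z; simp [add_mul, mul_add]; ring)
      (fun r x y => by ext z; simp [smul_sub, smul_add])
      (fun x y y' => by ext z; simp [add_mul, mul_add]; ring)
      (fun r x y => by ext z; simp [smul_sub, smul_add])
    have hT : T = 0 := by
      refine b.ext fun i => b.ext fun j => b.ext fun l => b.repr.injective (Finsupp.ext fun p => ?_)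
      have := e2 i j l p
      rw [h] at this
      simpa [T] using this.symm
    exact fun x y z => LinearMap.congr_fun (LinearMap.congr_fun₂ hT x y) z

theorem finrank_ker_cocycleMap {κ : Type*} [Field κ] [Algebra κ C] (b : Module.Basis (Fin n) κ C) :
    Module.finrank κ (LinearMap.ker (LinearMap.toMatrix'
      (cocycleMap fun i j l => b.repr (b i * b j) l)).mulVecLin) =
      Module.finrank κ (cocycles κ C) := by
  have h : (cocycles κ C).map (bilinEquiv b).toLinearMap =
      LinearMap.ker (LinearMap.toMatrix'
        (cocycleMap fun i j l => b.repr (b i * b j) l)).mulVecLin := by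
    ext v
    obtain ⟨φ, rfl⟩ := (bilinEquiv b).surjective v
    rw [LinearMap.mem_ker, ← Matrix.toLin'_apply', Matrix.toLin'_toMatrix', ← mem_cocycles_iff]
    simp
  rw [← h]
  exact LinearEquiv.finrank_map_eq _ _

end Coordinates

/-! ### Algebras from points of the moduli scheme -/

section PointAlg

variable {n : ℕ} {κ : Type u} [CommRing κ]

/-- The free module underlying the algebra with given structure constants. -/
def PointAlg (_x : Idx n → κ) : Type u := Fin n → κ

instance (x : Idx n → κ) : AddCommGroup (PointAlg x) := inferInstanceAs (AddCommGroup (Fin n → κ))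

instance (x : Idx n → κ) : Module κ (PointAlg x) := inferInstanceAs (Module κ (Fin n → κ))

/-- The standard basis. -/
noncomputable def PointAlg.basis (x : Idx n → κ) : Module.Basis (Fin n) κ (PointAlg x) :=
  Pi.basisFun κ (Fin n)

/-- The multiplication with given structure constants. -/
noncomputable def PointAlg.mulMap (x : Idx n → κ) :
    PointAlg x →ₗ[κ] PointAlg x →ₗ[κ] PointAlg x :=
  (PointAlg.basis x).constr κ fun i => (PointAlg.basis x).constr κ fun j =>
    ∑ l, x (Sum.inl (i, j, l)) • PointAlg.basis x l

theorem PointAlg.mulMap_basis (x : Idx n → κ) (i j : Fin n) :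
    PointAlg.mulMap x (PointAlg.basis x i) (PointAlg.basis x j) =
      ∑ l, x (Sum.inl (i, j, l)) • PointAlg.basis x l := by
  rw [PointAlg.mulMap, Module.Basis.constr_basis, Module.Basis.constr_basis]

/-- The generators of the ideal are the algebra axioms on basis vectors; multilinearity extends them
to all vectors. This is what gives an algebra over the residue field of an arbitrary, not only
rational, point. -/
theorem exists_coords_eq (x : Idx n → κ) (hx : ∀ f ∈ relIdeal n, MvPolynomial.aeval x f = 0) :
    ∃ (C : Type u) (_ : CommRing C) (_ : Algebra κ C) (b : Module.Basis (Fin n) κ C),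
      coords b = x := by
  have hcomm : ∀ i j l, x (Sum.inl (i, j, l)) = x (Sum.inl (j, i, l)) := fun i j l => by
    have := hx _ (Ideal.subset_span (Or.inl (Or.inl ⟨i, j, l, rfl⟩)))
    simpa [commRel, c, sub_eq_zero] using this
  have hassoc : ∀ i j l p, ∑ m, x (Sum.inl (i, j, m)) * x (Sum.inl (m, l, p)) =
      ∑ m, x (Sum.inl (j, l, m)) * x (Sum.inl (i, m, p)) := fun i j l p => by
    have := hx _ (Ideal.subset_span (Or.inl (Or.inr ⟨i, j, l, p, rfl⟩)))
    simpa [assocRel, c, sub_eq_zero] using this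
  have hunit : ∀ j l, ∑ i, x (Sum.inr i) * x (Sum.inl (i, j, l)) = if j = l then 1 else 0 :=
    fun j l => by
      have := hx _ (Ideal.subset_span (Or.inr ⟨j, l, rfl⟩))
      simp only [unitRel, c, d, map_sub, map_sum, map_mul, MvPolynomial.aeval_X] at this
      rw [sub_eq_zero.1 this]
      split_ifs <;> simp
  set b := PointAlg.basis x with hb
  set μ := PointAlg.mulMap x with hμ
  let e : PointAlg x := ∑ i, x (Sum.inr i) • b i
  have hc : ∀ u v, μ u v = μ v u := by
    have : μ = μ.flip := by
      refine b.ext fun i => b.ext fun j => ?_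
      simp [hμ, hb, PointAlg.mulMap_basis, hcomm i j]
    exact fun u v => LinearMap.congr_fun₂ this u v
  have ha : ∀ u v w, μ (μ u v) w = μ u (μ v w) := by
    let T : PointAlg x →ₗ[κ] PointAlg x →ₗ[κ] PointAlg x →ₗ[κ] PointAlg x :=
      LinearMap.mk₂ κ (fun u v => μ (μ u v) - μ u ∘ₗ μ v)
        (fun u u' v => by ext z; simp; abel)
        (fun r u v => by ext z; simp [smul_sub])
        (fun u v v' => by ext z; simp; abel)
        (fun r u v => by ext z; simp [smul_sub])
    have hT : T = 0 := by
      refine b.ext fun i => b.ext fun j => b.ext fun l => ?_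
      change μ (μ (b i) (b j)) (b l) - μ (b i) (μ (b j) (b l)) = 0
      simp only [hμ, hb, PointAlg.mulMap_basis, map_sum, map_smul, LinearMap.sum_apply,
        LinearMap.smul_apply, Finset.smul_sum, smul_smul]
      rw [Finset.sum_comm, sub_eq_zero]
      conv_rhs => rw [Finset.sum_comm]
      simp only [← Finset.sum_smul, hassoc]
    intro u v w
    exact sub_eq_zero.1 (LinearMap.congr_fun (LinearMap.congr_fun₂ hT u v) w)
  have h1 : ∀ u, μ e u = u := by
    have : μ e = LinearMap.id := by
      refine b.ext fun j => ?_
      simp only [e, map_sum, map_smul, LinearMap.sum_apply, LinearMap.smul_apply, hμ, hb,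
        PointAlg.mulMap_basis, Finset.smul_sum, smul_smul]
      rw [Finset.sum_comm]
      simp only [← Finset.sum_smul, hunit]
      simp
    exact fun u => LinearMap.congr_fun this u
  let R : CommRing (PointAlg x) :=
    { (inferInstance : AddCommGroup (PointAlg x)) with
      mul := fun u v => μ u v
      one := e
      left_distrib := fun u v w => map_add (μ u) v w
      right_distrib := fun u v w => LinearMap.map_add₂ μ u v w
      zero_mul := fun u => LinearMap.map_zero₂ μ u
      mul_zero := fun u => map_zero (μ u)
      mul_assoc := ha
      mul_comm := hc
      one_mul := h1
      mul_one := fun u => (hc u e).trans (h1 u) }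
  let A : Algebra κ (PointAlg x) := Algebra.ofModule (fun r u v => LinearMap.map_smul₂ μ r u v)
    (fun r u v => map_smul (μ u) r v)
  refine ⟨PointAlg x, R, A, b, ?_⟩
  ext (⟨i, j, l⟩ | i)
  · change b.repr (μ (b i) (b j)) l = _
    simp only [hμ, hb, PointAlg.mulMap_basis, Module.Basis.repr_sum_self]
  · change b.repr e i = _
    simp only [e, Module.Basis.repr_sum_self]

end PointAlg

/-! ### Discriminants and the closure criterion -/

theorem aeval_coords_Δ {n : ℕ} {R C : Type*} [CommRing R] [CommRing C] [Algebra R C]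
    (b : Module.Basis (Fin n) R C) :
    MvPolynomial.aeval (coords b) (Matrix.det (Matrix.of fun i j : Fin n =>
      ∑ l, c i j l * universalTrace l)) = Algebra.discr R b := by
  rw [Algebra.discr_def, AlgHom.map_det]
  congr 1
  ext i j
  have h : ∀ l, MvPolynomial.aeval (coords b) (universalTrace l) = Algebra.trace R C (b l) :=
    fun l => by
      simp [universalTrace, c, coords, Algebra.trace_eq_matrix_trace b, Matrix.trace,
        Algebra.leftMulMatrix_eq_repr_mul]
  have h2 : b i * b j = ∑ l, b.repr (b i * b j) l • b l := (b.sum_repr _).symm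
  rw [Algebra.traceMatrix_apply, Algebra.traceForm_apply]
  conv_rhs => rw [h2, map_sum]
  simp [h, c, coords]

theorem evalOver_one_tmul {n : ℕ} {k : Type u} [Field k] {C : Type*} [CommRing C] [Algebra k C]
    (b : Module.Basis (Fin n) k C) (x : CoordRing n) :
    evalOver b ((1 : k) ⊗ₜ[ℤ] x) = evalAt b x :=
  (Algebra.TensorProduct.lift_tmul (Algebra.ofId k k) (evalAt b) (fun _ _ => mul_comm _ _) 1
    x).trans (by rw [map_one, one_mul])

theorem evalOver_Δ {n : ℕ} {k : Type u} [Field k] {C : Type*} [CommRing C] [Algebra k C]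
    (b : Module.Basis (Fin n) k C) :
    evalOver b ((1 : k) ⊗ₜ[ℤ] Δ n) = Algebra.discr k b :=
  (evalOver_one_tmul b _).trans (aeval_coords_Δ b)

theorem comap_closedPoint_mem_basicOpen {k S : Type*} [Field k] [CommRing S] (p : S →+* k)
    (f : S) : PrimeSpectrum.comap p (IsLocalRing.closedPoint k) ∈ PrimeSpectrum.basicOpen f ↔
      p f ≠ 0 := by
  rw [PrimeSpectrum.mem_basicOpen, not_iff_not]
  change p f ∈ IsLocalRing.maximalIdeal k ↔ _
  rw [IsLocalRing.mem_maximalIdeal, mem_nonunits_iff, isUnit_iff_ne_zero, not_not]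

/-- A rational point whose algebra has fewer than `n ^ 2` cocycles is not in the closure of the
locus where the discriminant is invertible. -/
theorem comap_closedPoint_notMem_closure {n : ℕ} {k S C : Type u} [Field k] [CommRing S]
    [Algebra k S] [CommRing C] [Algebra k C] (b : Module.Basis (Fin n) k C)
    (h : Module.finrank k (cocycles k C) < n ^ 2) (p : S →ₐ[k] k) (s : Fin n → Fin n → Fin n → S)
    (disc : S) (hs : ∀ i j l, p (s i j l) = b.repr (b i * b j) l)
    (hdisc : ∀ {κ : Type u} [Field κ] (q : S →+* κ),
      ∃ (D : Type u) (_ : CommRing D) (_ : Algebra κ D) (b' : Module.Basis (Fin n) κ D),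
      (∀ i j l, b'.repr (b' i * b' j) l = q (s i j l)) ∧ Algebra.discr κ b' = q disc) :
    PrimeSpectrum.comap p.toRingHom (IsLocalRing.closedPoint k) ∉
      closure (PrimeSpectrum.basicOpen disc : Set (PrimeSpectrum S)) := by
  have hp : (LinearMap.toMatrix' (cocycleMap s)).map p =
      LinearMap.toMatrix' (cocycleMap fun i j l => b.repr (b i * b j) l) :=
    (map_toMatrix'_cocycleMap p.toRingHom s).trans (congrArg
      (fun t => LinearMap.toMatrix' (cocycleMap t)) (funext₃ hs))
  rw [← finrank_ker_cocycleMap b, ← hp] at h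
  obtain ⟨f, hf, hq⟩ := exists_finrank_ker_lt.{u} _ _ _ h
  intro hcl
  obtain ⟨y, hyf, hyΔ⟩ := mem_closure_iff.1 hcl _ (PrimeSpectrum.basicOpen f).isOpen
    ((comap_closedPoint_mem_basicOpen p.toRingHom f).2 (by
      change p f ≠ 0
      rw [hf]
      exact one_ne_zero))
  -- Over the residue field of a point common to both open sets, the same algebra has fewer than `n
  -- ^ 2` cocycles and also at least `n ^ 2`.
  let q := algebraMap S y.asIdeal.ResidueField
  have hne : ∀ g, y ∈ PrimeSpectrum.basicOpen g → q g ≠ 0 := fun g hg => by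
    rwa [Ne, Ideal.algebraMap_residueField_eq_zero]
  obtain ⟨D, _, _, b', hb', hd⟩ := hdisc q
  have h1 := hq q (hne f hyf)
  rw [map_toMatrix'_cocycleMap, ← show (fun i j l => b'.repr (b' i * b' j) l) =
    fun i j l => q (s i j l) from funext₃ hb', finrank_ker_cocycleMap] at h1
  have h2 := sq_le_finrank_cocycles b' (by rw [hd]; exact hne _ hyΔ)
  rw [Fintype.card_fin] at h2
  omega

/-- The coordinates of a specialization of the universal based algebra. -/
theorem exists_basis_of_ringHom {n : ℕ} {k κ : Type u} [Field k] [Field κ]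
    (q : CoordRingOver n k →+* κ) :
    ∃ (C : Type u) (_ : CommRing C) (_ : Algebra κ C) (b : Module.Basis (Fin n) κ C),
      (∀ i j l, b.repr (b i * b j) l = q (1 ⊗ₜ Ideal.Quotient.mk (relIdeal n) (c i j l))) ∧
      Algebra.discr κ b = q (1 ⊗ₜ Δ n) := by
  let r : MvPolynomial (Idx n) ℤ →+* κ :=
    (q.comp Algebra.TensorProduct.includeRight.toRingHom).comp (Ideal.Quotient.mk (relIdeal n))
  let x : Idx n → κ := fun t => r (MvPolynomial.X t)
  have hr : ∀ f, MvPolynomial.aeval x f = r f := by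
    have : (MvPolynomial.aeval (R := ℤ) x).toRingHom = r :=
      MvPolynomial.ringHom_ext (fun z => by simp) fun t => by simp [x]
    exact fun f => RingHom.congr_fun this f
  obtain ⟨C, i₁, i₂, b, hb⟩ := exists_coords_eq x fun f hf => by
    rw [hr]
    simp only [r, RingHom.comp_apply, Ideal.Quotient.eq_zero_iff_mem.2 hf, map_zero]
  refine ⟨C, i₁, i₂, b, fun i j l => congrFun hb (Sum.inl (i, j, l)), ?_⟩
  rw [← aeval_coords_Δ, hb, hr]
  rfl

/-- An algebra of rank `n` with fewer than `n ^ 2` cocycles is not a degeneration of étale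
algebras. -/
theorem point_notMem_closure {n : ℕ} {k C : Type u} [Field k] [CommRing C] [Algebra k C]
    (b : Module.Basis (Fin n) k C) (h : Module.finrank k (cocycles k C) < n ^ 2) :
    point b ∉ closure (etaleLocus n k : Set (𝔅Over n k)) := by
  let s : Fin n → Fin n → Fin n → CoordRingOver n k :=
    fun i j l => 1 ⊗ₜ Ideal.Quotient.mk (relIdeal n) (c i j l)
  have hs : ∀ i j l, evalOver b (s i j l) = b.repr (b i * b j) l :=
    fun _ _ _ => (evalOver_one_tmul b _).trans (MvPolynomial.aeval_X _ _)
  have key := comap_closedPoint_notMem_closure b h (evalOver b) s (1 ⊗ₜ Δ n) hs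
    fun q => exists_basis_of_ringHom q
  exact key

/-- The split algebra `k ^ n` in its basis of idempotents has the identity as trace matrix, over any
field. -/
theorem etaleLocus_nonempty (n : ℕ) (k : Type u) [Field k] :
    (etaleLocus n k : Set (𝔅Over n k)).Nonempty := by
  refine ⟨point (Pi.basisFun k (Fin n)), (comap_closedPoint_mem_basicOpen _ _).2 ?_⟩
  have h : Algebra.traceMatrix k (Pi.basisFun k (Fin n)) = 1 := by
    ext i j
    have h2 : Pi.basisFun k (Fin n) i * Pi.basisFun k (Fin n) j =
        if i = j then Pi.basisFun k (Fin n) i else 0 := by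
      ext l
      split_ifs with hij
      · simp [hij, Pi.single_apply]
      · simp only [Pi.basisFun_apply, Pi.mul_apply, Pi.single_apply, Pi.zero_apply]
        grind
    have h3 : Algebra.trace k _ (Pi.basisFun k (Fin n) i) = 1 := by
      rw [Algebra.trace_eq_matrix_trace (Pi.basisFun k (Fin n)), Matrix.trace]
      simp only [Matrix.diag_apply, Algebra.leftMulMatrix_eq_repr_mul]
      simp [Pi.single_apply]
    rw [Algebra.traceMatrix_apply, Algebra.traceForm_apply, h2, Matrix.one_apply]
    split_ifs
    · exact h3
    · exact map_zero _
  change evalOver (Pi.basisFun k (Fin n)) _ ≠ 0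
  rw [evalOver_Δ, Algebra.discr_def, h, Matrix.det_one]
  exact one_ne_zero

theorem not_irreducibleSpace {n : ℕ} {k C : Type u} [Field k] [CommRing C] [Algebra k C]
    (b : Module.Basis (Fin n) k C) (h : Module.finrank k (cocycles k C) < n ^ 2) :
    ¬ IrreducibleSpace (𝔅Over n k) := fun _ =>
  point_notMem_closure b h
    (((etaleLocus n k).isOpen.dense (etaleLocus_nonempty n k)) (point b))

/-! ### The witness algebra and its monomial basis -/

namespace Witness

variable (k : Type u) [Field k]

/-- The generators of the witness algebra. -/
noncomputable def x (i : Fin 4) : Witness k := Ideal.Quotient.mk (witnessIdeal k) (MvPolynomial.X i)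

theorem relations : x k 0 * x k 0 = 0 ∧ x k 0 * x k 1 = 0 ∧ x k 1 * x k 1 = 0 ∧ x k 2 * x k 2 = 0 ∧
    x k 2 * x k 3 = 0 ∧ x k 3 * x k 3 = 0 ∧ x k 1 * x k 2 = x k 0 * x k 3 := by
  refine ⟨?_, ?_, ?_, ?_, ?_, ?_, (sub_eq_zero.1 ?_).symm⟩ <;>
  · simp only [x, ← map_mul, ← map_sub, Ideal.Quotient.eq_zero_iff_mem]
    exact Ideal.subset_span (by simp [sq])

/-- The monomial basis of the witness algebra, as a family. -/
noncomputable def monomials : Fin 8 → Witness k :=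
  ![1, x k 0, x k 1, x k 2, x k 3, x k 0 * x k 2, x k 0 * x k 3, x k 1 * x k 3]

theorem exists_dual_extension (P : Type u) [CommRing P] :
    ∃ (R : Type u) (_ : CommRing R) (ι : P →+* R) (e : R), e * e = 0 ∧
      ∀ p q, ι p + ι q * e = 0 → p = 0 ∧ q = 0 := by
  refine ⟨DualNumber P, inferInstance, TrivSqZeroExt.inlHom P P, DualNumber.eps,
    DualNumber.eps_mul_eps, fun p q h => ?_⟩
  have h1 := congrArg TrivSqZeroExt.fst h
  have h2 := congrArg TrivSqZeroExt.snd h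
  exact ⟨by simpa using h1, by simpa using h2⟩

/-- The witness algebra embeds into `k[t, ε₁, ε₂]` by `a ↦ ε₁`, `b ↦ ε₁ t`, `c ↦ ε₂`,
`d ↦ ε₂ t`. -/
theorem exists_ringHom : ∃ (R : Type u) (_ : CommRing R) (ι : Polynomial k →+* R) (e₁ e₂ : R)
    (f : Witness k →+* R), (∀ r, f (algebraMap k _ r) = ι (Polynomial.C r)) ∧
      f (x k 0) = e₁ ∧ f (x k 1) = e₁ * ι Polynomial.X ∧ f (x k 2) = e₂ ∧
      f (x k 3) = e₂ * ι Polynomial.X ∧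
      ∀ p q r s, ι p + ι q * e₁ + (ι r + ι s * e₁) * e₂ = 0 → p = 0 ∧ q = 0 ∧ r = 0 ∧ s = 0 := by
  obtain ⟨P, _, ι₁, e₁, h₁, hi₁⟩ := exists_dual_extension (Polynomial k)
  obtain ⟨R, _, ι₂, e₂, h₂, hi₂⟩ := exists_dual_extension P
  let ι := ι₂.comp ι₁
  have h₁' : ι₂ e₁ * ι₂ e₁ = 0 := by rw [← map_mul, h₁, map_zero]
  let g : MvPolynomial (Fin 4) k →+* R := MvPolynomial.eval₂Hom (ι.comp Polynomial.C)
    ![ι₂ e₁, ι₂ e₁ * ι Polynomial.X, e₂, e₂ * ι Polynomial.X]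
  have hg : ∀ i, g (MvPolynomial.X i) =
      ![ι₂ e₁, ι₂ e₁ * ι Polynomial.X, e₂, e₂ * ι Polynomial.X] i :=
    fun i => MvPolynomial.eval₂Hom_X' _ _ i
  have hker : witnessIdeal k ≤ RingHom.ker g := by
    refine Ideal.span_le.2 ?_
    rintro f (rfl | rfl | rfl | rfl | rfl | rfl | rfl) <;>
      simp only [SetLike.mem_coe, RingHom.mem_ker, map_sub, map_mul, sq, hg, Matrix.cons_val]
    · exact h₁'
    · linear_combination ι Polynomial.X * h₁'
    · linear_combination ι Polynomial.X ^ 2 * h₁'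
    · exact h₂
    · linear_combination ι Polynomial.X * h₂
    · linear_combination ι Polynomial.X ^ 2 * h₂
    · ring
  let f : Witness k →+* R := Ideal.Quotient.lift (witnessIdeal k) g fun _ ha => hker ha
  refine ⟨R, _, ι, ι₂ e₁, e₂, f, fun r => MvPolynomial.eval₂Hom_C _ _ r, hg 0, hg 1, hg 2, hg 3,
    fun p q r s h => ?_⟩
  obtain ⟨hp, hr⟩ := hi₂ (ι₁ p + ι₁ q * e₁) (ι₁ r + ι₁ s * e₁) (by
    simp only [map_add, map_mul]
    exact h)
  exact ⟨(hi₁ p q hp).1, (hi₁ p q hp).2, (hi₁ r s hr).1, (hi₁ r s hr).2⟩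

theorem linearIndependent_monomials : LinearIndependent k (monomials k) := by
  rw [Fintype.linearIndependent_iff]
  intro g hg
  obtain ⟨R, _, ι, e₁, e₂, f, hf, f0, f1, f2, f3, hι⟩ := exists_ringHom k
  have hs : ∀ (r : k) (y : Witness k), f (r • y) = ι (Polynomial.C r) * f y := fun r y => by
    rw [← hf, ← map_mul]
    exact congrArg f (Algebra.smul_def r y)
  have h := congrArg f hg
  simp only [Fin.sum_univ_eight, monomials, Matrix.cons_val, map_add, hs, map_mul,
    map_one, map_zero, f0, f1, f2, f3] at h
  -- The images of the monomials are `1`, `ε₁{1, t}`, `ε₂{1, t}` and `ε₁ε₂{1, t, t²}`, so every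
  -- coefficient can be read off.
  obtain ⟨h0, h1, h2, h3⟩ := hι (Polynomial.C (g 0))
    (Polynomial.C (g 1) + Polynomial.C (g 2) * Polynomial.X)
    (Polynomial.C (g 3) + Polynomial.C (g 4) * Polynomial.X)
    (Polynomial.C (g 5) + Polynomial.C (g 6) * Polynomial.X +
      Polynomial.C (g 7) * Polynomial.X ^ 2) (by
      simp only [map_add, map_mul, map_pow]
      linear_combination h)
  have e (p : Polynomial k) (hp : p = 0) (i : ℕ) : p.coeff i = 0 := by simp [hp]
  have c0 := e _ h0 0
  have c1 := e _ h1 0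
  have c2 := e _ h1 1
  have c3 := e _ h2 0
  have c4 := e _ h2 1
  have c5 := e _ h3 0
  have c6 := e _ h3 1
  have c7 := e _ h3 2
  simp [Polynomial.coeff_X, Polynomial.coeff_C, Polynomial.coeff_X_pow] at c0 c1 c2 c3 c4 c5 c6 c7
  intro i
  fin_cases i <;> assumption

/-- Multiplying a monomial by a generator never leaves the list, up to zero: this makes the span of
the monomials stable, hence everything. -/
theorem monomial_mul_eq {R : Type*} [CommRing R] {a b c d : R} (haa : a * a = 0) (hab : a * b = 0)
    (hbb : b * b = 0) (hcc : c * c = 0) (hcd : c * d = 0) (hdd : d * d = 0) (hbc : b * c = a * d)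
    (j : Fin 8) (i : Fin 4) :
    ![1, a, b, c, d, a * c, a * d, b * d] j * ![a, b, c, d] i = 0 ∨
    ∃ l, ![1, a, b, c, d, a * c, a * d, b * d] j * ![a, b, c, d] i =
      ![1, a, b, c, d, a * c, a * d, b * d] l := by
  simp only [Fin.exists_fin_succ]
  fin_cases j <;> fin_cases i <;> simp <;> grind

theorem span_monomials : ⊤ ≤ Submodule.span k (Set.range (monomials k)) := by
  obtain ⟨h00, h01, h11, h22, h23, h33, h12⟩ := relations k
  set W := Submodule.span k (Set.range (monomials k)) with hW
  have hmem : ∀ i, monomials k i ∈ W := fun i => Submodule.subset_span ⟨i, rfl⟩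
  have hmul : ∀ i, ∀ y ∈ W, y * x k i ∈ W := by
    intro i y hy
    induction hy using Submodule.span_induction with
    | zero => simp
    | add u v _ _ hu hv => rw [add_mul]; exact add_mem hu hv
    | smul r u _ hu => rw [smul_mul_assoc]; exact W.smul_mem r hu
    | mem u hu =>
      obtain ⟨j, rfl⟩ := hu
      have hx : x k i = ![x k 0, x k 1, x k 2, x k 3] i := by fin_cases i <;> rfl
      rcases monomial_mul_eq h00 h01 h11 h22 h23 h33 h12 j i with h | ⟨l, h⟩ <;> rw [← hx] at h
      · exact h ▸ zero_mem W
      · exact h ▸ hmem l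
  rintro y -
  obtain ⟨f, rfl⟩ := Ideal.Quotient.mk_surjective y
  induction f using MvPolynomial.induction_on with
  | C r =>
    have : Ideal.Quotient.mk (witnessIdeal k) (MvPolynomial.C r) = r • monomials k 0 := by
      exact (Algebra.smul_def r (1 : Witness k)).trans (mul_one _) |>.symm
    rw [this]
    exact W.smul_mem r (hmem 0)
  | add f g hf hg => rw [map_add]; exact add_mem hf hg
  | mul_X f i hf => rw [map_mul]; exact hmul i _ hf

/-- The monomial basis of the witness algebra. -/
noncomputable def basis : Module.Basis (Fin 8) k (Witness k) :=
  Module.Basis.mk (linearIndependent_monomials k) (span_monomials k)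

theorem finrank_eq : Module.finrank k (Witness k) = 8 := by
  rw [Module.finrank_eq_card_basis (basis k), Fintype.card_fin]

end Witness

/-! ### Cocycles on the witness -/

section LocalPart

variable {k A : Type*} [Field k] [CommRing A] [Algebra k A] {a b c d : A}

/-- Products of degree three vanish, so the equations cannot see degree-two parts of `P`, `Q`, `R`;
those are assumed absent. The remaining coefficients are eliminated by comparison in degrees one and
two. -/
theorem eq_zero_of_syzygies (haa : a * a = 0) (hab : a * b = 0)
    (hbb : b * b = 0) (hcc : c * c = 0) (hcd : c * d = 0) (hdd : d * d = 0) (hbc : b * c = a * d)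
    (hli : ∀ g : Fin 8 → k, g 0 • 1 + g 1 • a + g 2 • b + g 3 • c + g 4 • d + g 5 • (a * c) +
      g 6 • (a * d) + g 7 • (b * d) = 0 → g = 0) {p q r : Fin 5 → k} {P Q R : A}
    (hP : P = p 0 • 1 + p 1 • a + p 2 • b + p 3 • c + p 4 • d)
    (hQ : Q = q 0 • 1 + q 1 • a + q 2 • b + q 3 • c + q 4 • d)
    (hR : R = r 0 • 1 + r 1 • a + r 2 • b + r 3 • c + r 4 • d)
    (h1 : b * P = a * Q) (h2 : b * Q = a * R) (h3 : d * P = c * Q) (h4 : d * Q = c * R) :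
    P = 0 ∧ Q = 0 ∧ R = 0 := by
  -- The entries are the coefficients of `b * P - a * Q` in the monomial basis; `p 3 - q 4` arises
  -- because `b * c = a * d`.
  have e1 := hli ![0, -q 0, p 0, 0, 0, -q 3, p 3 - q 4, p 4] (by
    rw [hP, hQ] at h1
    simp only [Algebra.smul_def, Matrix.cons_val, map_neg, map_sub, map_zero] at h1 ⊢
    linear_combination h1 - algebraMap k A (p 1) * hab - algebraMap k A (p 2) * hbb -
      algebraMap k A (p 3) * hbc + algebraMap k A (q 1) * haa + algebraMap k A (q 2) * hab)
  have e2 := hli ![0, -r 0, q 0, 0, 0, -r 3, q 3 - r 4, q 4] (by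
    rw [hQ, hR] at h2
    simp only [Algebra.smul_def, Matrix.cons_val, map_neg, map_sub, map_zero] at h2 ⊢
    linear_combination h2 - algebraMap k A (q 1) * hab - algebraMap k A (q 2) * hbb -
      algebraMap k A (q 3) * hbc + algebraMap k A (r 1) * haa + algebraMap k A (r 2) * hab)
  have e3 := hli ![0, 0, 0, -q 0, p 0, -q 1, p 1 - q 2, p 2] (by
    rw [hP, hQ] at h3
    simp only [Algebra.smul_def, Matrix.cons_val, map_neg, map_sub, map_zero] at h3 ⊢
    linear_combination h3 - algebraMap k A (p 3) * hcd - algebraMap k A (p 4) * hdd +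
      algebraMap k A (q 2) * hbc + algebraMap k A (q 3) * hcc + algebraMap k A (q 4) * hcd)
  have e4 := hli ![0, 0, 0, -r 0, q 0, -r 1, q 1 - r 2, q 2] (by
    rw [hQ, hR] at h4
    simp only [Algebra.smul_def, Matrix.cons_val, map_neg, map_sub, map_zero] at h4 ⊢
    linear_combination h4 - algebraMap k A (q 3) * hcd - algebraMap k A (q 4) * hdd +
      algebraMap k A (r 2) * hbc + algebraMap k A (r 3) * hcc + algebraMap k A (r 4) * hcd)
  simp only [funext_iff, Fin.forall_fin_succ, Matrix.cons_val, Fin.succ, Pi.zero_apply]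
    at e1 e2 e3 e4
  simp at e1 e2 e3 e4
  have hp : ∀ i, p i = 0 := by intro i; fin_cases i <;> simp <;> grind
  have hq : ∀ i, q i = 0 := by intro i; fin_cases i <;> simp <;> grind
  have hr : ∀ i, r i = 0 := by intro i; fin_cases i <;> simp <;> grind
  simp [hP, hQ, hR, hp, hq, hr]

/-- The cocycle identity turns syzygies of the relations into linear equations on the values at `(a,
a), (a, b), (b, b)` and at `(c, c), (c, d), (d, d)`. Once these vanish, all generator pairs do, and
the identity propagates this to higher degree. -/
theorem cocycle_apply_eq_zero {ψ : A →ₗ[k] A →ₗ[k] A} (hψ : ψ ∈ cocycles k A)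
    (haa : a * a = 0) (hab : a * b = 0)
    (hbb : b * b = 0) (hcc : c * c = 0) (hcd : c * d = 0) (hdd : d * d = 0) (hbc : b * c = a * d)
    (hli : ∀ g : Fin 8 → k, g 0 • 1 + g 1 • a + g 2 • b + g 3 • c + g 4 • d + g 5 • (a * c) +
      g 6 • (a * d) + g 7 • (b * d) = 0 → g = 0)
    (h1 : ∀ y, ψ 1 y = 0) (hac : ψ a c = 0) (had : ψ a d = 0) (hbc' : ψ b c = 0) (hbd : ψ b d = 0)
    (hsq : ∀ i, ∃ p : Fin 5 → k, ![ψ a a, ψ a b, ψ b b, ψ c c, ψ c d, ψ d d] i =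
      p 0 • 1 + p 1 • a + p 2 • b + p 3 • c + p 4 • d) (i j : Fin 8) :
    ψ (![1, a, b, c, d, a * c, a * d, b * d] i) (![1, a, b, c, d, a * c, a * d, b * d] j) = 0 := by
  obtain ⟨hsymm, hco⟩ := hψ
  obtain ⟨p, hp⟩ := hsq 0
  obtain ⟨q, hq⟩ := hsq 1
  obtain ⟨r, hr⟩ := hsq 2
  obtain ⟨s, hs⟩ := hsq 3
  obtain ⟨t, ht⟩ := hsq 4
  obtain ⟨u, hu⟩ := hsq 5
  simp only [Matrix.cons_val] at hp hq hr hs ht hu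
  have z : ∀ y, ψ y 0 = 0 := fun y => map_zero _
  -- For instance `d * ψ a a` and `c * ψ a b` both equal `ψ (a * d) a`, by the identities for `(d,
  -- a, a)` and `(c, b, a)` and `b * c = a * d`.
  obtain ⟨paa, pab, pbb⟩ := eq_zero_of_syzygies haa hab hbb hcc hcd hdd hbc hli hp hq hr
    (by have := hco b a a; grind) (by have := hco b b a; grind)
    (by have := hco d a a; have := hco c b a; grind) (by have := hco d a b; have := hco c b b; grind)
  obtain ⟨pcc, pcd, pdd⟩ := eq_zero_of_syzygies haa hab hbb hcc hcd hdd hbc hli hs ht hu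
    (by have := hco b c c; have := hco a d c; grind) (by have := hco b c d; have := hco a d d; grind)
    (by have := hco d c c; grind) (by have := hco d d c; grind)
  have gen : ∀ i j : Fin 4, ψ (![a, b, c, d] i) (![a, b, c, d] j) = 0 := by
    intro i j
    fin_cases i <;> fin_cases j <;> simp <;> first | assumption | (rw [hsymm]; assumption)
  have prod : ∀ x y w, y * w = 0 → ψ x y = 0 → ψ y w = 0 → ψ (x * y) w = 0 := by
    intro x y w hy hxy hyw
    have := hco x y w
    rw [hy, z, hxy, hyw] at this
    linear_combination -this
  -- Each degree-two monomial is factored so that its second factor annihilates the given generator.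
  have cub : ∀ (i : Fin 3) (j : Fin 4), ψ (![a * c, a * d, b * d] i) (![a, b, c, d] j) = 0 := by
    have hca : ψ c a = 0 := gen 2 0
    have hda : ψ d a = 0 := gen 3 0
    have hdb : ψ d b = 0 := gen 3 1
    intro i j
    fin_cases i <;> fin_cases j <;> simp only [Fin.mk_zero, Fin.mk_one,
      Fin.reduceFinMk, Matrix.cons_val]
    · rw [mul_comm a]; exact prod c a a haa hca paa
    · rw [mul_comm a]; exact prod c a b hab hca pab
    · exact prod a c c hcc hac pcc
    · exact prod a c d hcd hac pcd
    · rw [mul_comm a]; exact prod d a a haa hda paa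
    · rw [mul_comm a]; exact prod d a b hab hda pab
    · exact prod a d c ((mul_comm d c).trans hcd) had (gen 3 2)
    · exact prod a d d hdd had pdd
    · rw [mul_comm b]; exact prod d b a ((mul_comm b a).trans hab) hdb (gen 1 0)
    · rw [mul_comm b]; exact prod d b b hbb hdb pbb
    · exact prod b d c ((mul_comm d c).trans hcd) hbd (gen 3 2)
    · exact prod b d d hdd hbd pdd
  have quart : ∀ i j : Fin 3, ψ (![a * c, a * d, b * d] i) (![a * c, a * d, b * d] j) = 0 := by
    have hc : ∀ j : Fin 3, c * ![a * c, a * d, b * d] j = 0 ∧ d * ![a * c, a * d, b * d] j = 0 := by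
      intro j
      fin_cases j <;> simp <;> grind
    intro i j
    fin_cases i
    · exact prod a c _ (hc j).1 hac ((hsymm _ _).trans (cub j 2))
    · exact prod a d _ (hc j).2 had ((hsymm _ _).trans (cub j 3))
    · exact prod b d _ (hc j).2 hbd ((hsymm _ _).trans (cub j 3))
  have split : ∀ i : Fin 8, i = 0 ∨
      (∃ l, ![1, a, b, c, d, a * c, a * d, b * d] i = ![a, b, c, d] l) ∨
      ∃ l, ![1, a, b, c, d, a * c, a * d, b * d] i = ![a * c, a * d, b * d] l := by
    intro i
    fin_cases i
    exacts [Or.inl rfl, Or.inr (Or.inl ⟨0, rfl⟩), Or.inr (Or.inl ⟨1, rfl⟩), Or.inr (Or.inl ⟨2, rfl⟩),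
      Or.inr (Or.inl ⟨3, rfl⟩), Or.inr (Or.inr ⟨0, rfl⟩), Or.inr (Or.inr ⟨1, rfl⟩),
      Or.inr (Or.inr ⟨2, rfl⟩)]
  rcases split i with rfl | ⟨l, hl⟩ | ⟨l, hl⟩
  · exact h1 _
  · rcases split j with rfl | ⟨l', hl'⟩ | ⟨l', hl'⟩
    · rw [hsymm]; exact h1 _
    · rw [hl, hl', gen]
    · rw [hl, hl', hsymm, cub]
  · rcases split j with rfl | ⟨l', hl'⟩ | ⟨l', hl'⟩
    · rw [hsymm]; exact h1 _
    · rw [hl, hl', cub]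
    · rw [hl, hl', quart]

end LocalPart

/-! ### Splitting off the factor `k ^ m` -/

section ProductPart

variable {k A : Type*} [Field k] [CommRing A] [Algebra k A] {m : ℕ}

/-- The identities for `(e, e, f)` and `(f, f, e)` show that `φ e f` is fixed by both `e` and `f`,
hence zero since `e * f = 0`; the one for `(e, f, y)` then gives the claim. -/
theorem cocycle_idempotent_apply_eq_zero {C : Type*} [CommRing C] [Algebra k C]
    {φ : C →ₗ[k] C →ₗ[k] C} (hφ : φ ∈ cocycles k C) {e f : C} (he : e * e = e) (hf : f * f = f)
    (hef : e * f = 0) (hee : φ e e = 0) (hff : φ f f = 0) {y : C} (hfy : f * y = y)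
    (hy : φ f y = 0) : φ e y = 0 := by
  obtain ⟨hsymm, hco⟩ := hφ
  have h1 := hco e e f
  have h2 := hco f f e
  have h3 := hco e f y
  rw [he, hef, hee, map_zero] at h1
  rw [hf, mul_comm f e, hef, hff, map_zero, hsymm f e] at h2
  rw [hef, hfy, hy, LinearMap.map_zero₂] at h3
  have h4 : φ e f = 0 := by linear_combination -(1 : C) * h1 - e * h2 + hef * φ e f
  rw [h4] at h3
  linear_combination h3

/-- A cocycle which vanishes on suitable pairs with an idempotent vanishes on the complement of the
local factor. -/
theorem cocycle_prod_apply {φ : (A × (Fin m → k)) →ₗ[k] (A × (Fin m → k)) →ₗ[k] (A × (Fin m → k))}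
    (hφ : φ ∈ cocycles k (A × (Fin m → k)))
    (h0 : ∀ w : A, (φ (1, 0) (w, 0)).2 = 0) (h1 : φ (1, 0) (1, 0) = 0)
    (hj : ∀ j, φ (0, Pi.single j 1) (0, Pi.single j 1) = 0) (x y : A × (Fin m → k)) :
    φ x y = ((φ (x.1, 0) (y.1, 0)).1, 0) ∧ φ (1, 0) y = 0 := by
  have e00 : ((1, 0) : A × (Fin m → k)) * (1, 0) = (1, 0) := by simp
  have ejj : ∀ j, ((0, Pi.single j 1) : A × (Fin m → k)) * (0, Pi.single j 1) =
      (0, Pi.single j 1) := fun j => by simp [← Pi.single_mul]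
  have e0j : ∀ j, ((1, 0) : A × (Fin m → k)) * (0, Pi.single j 1) = 0 := fun j => by simp
  have eij : ∀ i j, i ≠ j → ((0, Pi.single i 1) : A × (Fin m → k)) * (0, Pi.single j 1) = 0 :=
    fun i j hij => by
      ext l
      · simp
      · simp [Pi.single_apply]
        grind
  -- The identity for `(1, 0), (1, 0), (w, 0)` kills the first component, so only the second needs a
  -- hypothesis.
  have hw : ∀ w : A, φ (1, 0) (w, 0) = 0 := fun w => by
    have := hφ.2 (1, 0) (1, 0) (w, 0)
    rw [e00, h1] at this
    have h3 := congrArg Prod.fst this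
    refine Prod.ext ?_ (h0 w)
    simpa using h3
  have hjw : ∀ j (w : A), φ (0, Pi.single j 1) (w, 0) = 0 := fun j w =>
    cocycle_idempotent_apply_eq_zero hφ (ejj j) e00 ((mul_comm _ _).trans (e0j j)) (hj j) h1
      (by simp) (hw w)
  have h0j : ∀ j, φ (1, 0) (0, Pi.single j 1) = 0 := fun j =>
    (hφ.1 _ _).trans (hjw j 1)
  have hij : ∀ i j, φ (0, Pi.single i 1) (0, Pi.single j 1) = 0 := fun i j => by
    by_cases h : i = j
    · exact h ▸ hj i
    · exact cocycle_idempotent_apply_eq_zero hφ (ejj i) (ejj j) (eij i j h) (hj i) (hj j) (ejj j)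
        (hj j)
  have hsum : ∀ v : Fin m → k, ((0, v) : A × (Fin m → k)) =
      ∑ j, v j • ((0, Pi.single j 1) : A × (Fin m → k)) := fun v => by
    refine Prod.ext ?_ ?_
    · simp [Prod.fst_sum]
    · simp only [Prod.snd_sum, Prod.smul_snd]
      ext l
      simp [Pi.single_apply]
  have hsplit : ∀ x : A × (Fin m → k), x = (x.1, 0) + (0, x.2) := fun x => by simp
  have h0v : ∀ v, φ (1, 0) (0, v) = 0 := fun v => by
    simp only [hsum v, map_sum, map_smul, h0j, smul_zero, Finset.sum_const_zero]
  have hwv : ∀ v w, φ (0, v) (w, 0) = 0 := fun v w => by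
    simp only [hsum v, map_sum, map_smul, LinearMap.sum_apply, LinearMap.smul_apply, hjw, smul_zero,
      Finset.sum_const_zero]
  have hvv : ∀ v w, φ (0, v) (0, w) = 0 := fun v w => by
    simp only [hsum v, hsum w, map_sum, map_smul, LinearMap.sum_apply, LinearMap.smul_apply, hij,
      smul_zero, Finset.sum_const_zero]
  have h1y : ∀ y, φ (1, 0) y = 0 := fun y => by rw [hsplit y, map_add, hw, h0v, add_zero]
  refine ⟨?_, h1y y⟩
  have hxy : φ x y = φ (x.1, 0) (y.1, 0) := by
    conv_lhs => rw [hsplit x, hsplit y]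
    rw [map_add, map_add, LinearMap.add_apply, LinearMap.add_apply, hwv, hvv,
      hφ.1 (x.1, 0) (0, y.2), hwv, add_zero, add_zero, add_zero]
  rw [hxy]
  refine Prod.ext rfl ?_
  -- With `(1, 0)` as first argument, the identity says that the value is fixed by multiplication by
  -- `(1, 0)`.
  have := congrArg Prod.snd (hφ.2 (1, 0) (x.1, 0) (y.1, 0))
  simp only [h1y] at this
  simpa using this

/-- The component of a bilinear map on the first factor. -/
def fstComponent (φ : (A × (Fin m → k)) →ₗ[k] (A × (Fin m → k)) →ₗ[k] (A × (Fin m → k))) :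
    A →ₗ[k] A →ₗ[k] A :=
  (φ.compl₁₂ (LinearMap.inl k A (Fin m → k)) (LinearMap.inl k A (Fin m → k))).compr₂
    (LinearMap.fst k A (Fin m → k))

theorem fstComponent_apply
    (φ : (A × (Fin m → k)) →ₗ[k] (A × (Fin m → k)) →ₗ[k] (A × (Fin m → k))) (x y : A) :
    fstComponent φ x y = (φ (x, 0) (y, 0)).1 := rfl

theorem fstComponent_mem_cocycles
    {φ : (A × (Fin m → k)) →ₗ[k] (A × (Fin m → k)) →ₗ[k] (A × (Fin m → k))}
    (hφ : φ ∈ cocycles k (A × (Fin m → k))) : fstComponent φ ∈ cocycles k A := by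
  refine ⟨fun x y => congrArg Prod.fst (hφ.1 (x, 0) (y, 0)), fun x y z => ?_⟩
  have := congrArg Prod.fst (hφ.2 (x, 0) (y, 0) (z, 0))
  simpa [fstComponent_apply] using this

end ProductPart

/-! ### Counting parameters -/

section Bound

variable (k : Type u) [Field k] (m : ℕ)

/-- Evaluation of a bilinear map at a pair. -/
def evalBilin {C : Type*} [CommRing C] [Algebra k C] (x y : C) : (C →ₗ[k] C →ₗ[k] C) →ₗ[k] C :=
  LinearMap.applyₗ y ∘ₗ LinearMap.applyₗ x

/-- Coordinates which determine a cocycle on the product of the witness with split factors. -/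
noncomputable def cocycleData :
    ((Witness k × (Fin m → k)) →ₗ[k] (Witness k × (Fin m → k)) →ₗ[k] (Witness k × (Fin m → k)))
    →ₗ[k] (Fin m → Witness k × (Fin m → k)) × (Witness k × (Fin m → k)) ×
      (Fin 7 → Fin m → k) × (Fin 4 → Witness k) × (Fin 6 → Fin 3 → k) :=
  (LinearMap.pi fun j => evalBilin k (0, Pi.single j 1) (0, Pi.single j 1)).prod <|
  (evalBilin k (1, 0) (1, 0)).prod <|
  (LinearMap.pi fun i : Fin 7 =>
    LinearMap.snd k _ _ ∘ₗ evalBilin k (1, 0) (Witness.monomials k i.succ, 0)).prod <|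
  (LinearMap.pi fun i : Fin 4 => LinearMap.fst k _ _ ∘ₗ evalBilin k
    (Witness.x k (![0, 0, 1, 1] i), 0) (Witness.x k (![2, 3, 2, 3] i), 0)).prod <|
  LinearMap.pi fun i : Fin 6 => LinearMap.pi fun l : Fin 3 =>
    (Witness.basis k).coord (Fin.natAdd 5 l) ∘ₗ LinearMap.fst k _ _ ∘ₗ evalBilin k
    (Witness.x k (![0, 0, 1, 2, 2, 3] i), 0) (Witness.x k (![0, 1, 1, 2, 3, 3] i), 0)

/-- The idempotent data reduce the cocycle to its local component; the mixed products and the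
degree-two coordinates of the six quadratic values are what the local argument needs. -/
theorem eq_zero_of_cocycleData_eq_zero
    {φ : (Witness k × (Fin m → k)) →ₗ[k] (Witness k × (Fin m → k)) →ₗ[k] (Witness k × (Fin m → k))}
    (hφ : φ ∈ cocycles k (Witness k × (Fin m → k))) (h : cocycleData k m φ = 0) : φ = 0 := by
  have hj : ∀ j, φ (0, Pi.single j 1) (0, Pi.single j 1) = 0 :=
    fun j => congrFun (congrArg (fun t => t.1) h) j
  have h1 : φ (1, 0) (1, 0) = 0 := congrArg (fun t => t.2.1) h
  have h7 : ∀ i : Fin 7, (φ (1, 0) (Witness.monomials k i.succ, 0)).2 = 0 :=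
    fun i => congrFun (congrArg (fun t => t.2.2.1) h) i
  have h4 : ∀ i : Fin 4, fstComponent φ (Witness.x k (![0, 0, 1, 1] i))
      (Witness.x k (![2, 3, 2, 3] i)) = 0 :=
    fun i => congrFun (congrArg (fun t => t.2.2.2.1) h) i
  have h6 : ∀ (i : Fin 6) (l : Fin 3), (Witness.basis k).repr (fstComponent φ
      (Witness.x k (![0, 0, 1, 2, 2, 3] i)) (Witness.x k (![0, 1, 1, 2, 3, 3] i)))
      (Fin.natAdd 5 l) = 0 :=
    fun i l => congrFun (congrFun (congrArg (fun t => t.2.2.2.2) h) i) l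
  have hb : ∀ i, Witness.basis k i = Witness.monomials k i := fun i => by
    rw [Witness.basis, Module.Basis.mk_apply]
  have h0 : ∀ w : Witness k, (φ (1, 0) (w, 0)).2 = 0 := by
    let f : Witness k →ₗ[k] (Fin m → k) :=
      LinearMap.snd k _ _ ∘ₗ φ (1, 0) ∘ₗ LinearMap.inl k (Witness k) (Fin m → k)
    have : f = 0 := by
      refine (Witness.basis k).ext fun i => ?_
      rw [hb]
      refine Fin.cases ?_ (fun i => h7 i) i
      exact congrArg Prod.snd h1
    exact fun w => LinearMap.congr_fun this w
  have hprod := cocycle_prod_apply hφ h0 h1 hj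
  obtain ⟨haa, hab, hbb, hcc, hcd, hdd, hbc⟩ := Witness.relations k
  have key : fstComponent φ = 0 := by
    refine (Witness.basis k).ext fun i => (Witness.basis k).ext fun j => ?_
    rw [hb, hb]
    refine cocycle_apply_eq_zero (fstComponent_mem_cocycles hφ) haa hab hbb hcc hcd hdd hbc
      (fun g hg => ?_) (fun y => congrArg Prod.fst (hprod 0 (y, 0)).2) (h4 0) (h4 1) (h4 2) (h4 3)
      (fun i => ?_) i j
    · refine funext (Fintype.linearIndependent_iff.1 (Witness.linearIndependent_monomials k) g ?_)
      rw [Fin.sum_univ_eight]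
      exact hg
    · have hi : ![fstComponent φ (Witness.x k 0) (Witness.x k 0),
          fstComponent φ (Witness.x k 0) (Witness.x k 1),
          fstComponent φ (Witness.x k 1) (Witness.x k 1),
          fstComponent φ (Witness.x k 2) (Witness.x k 2),
          fstComponent φ (Witness.x k 2) (Witness.x k 3),
          fstComponent φ (Witness.x k 3) (Witness.x k 3)] i =
          fstComponent φ (Witness.x k (![0, 0, 1, 2, 2, 3] i))
            (Witness.x k (![0, 1, 1, 2, 3, 3] i)) := by
        fin_cases i <;> rfl
      rw [hi]
      set P := fstComponent φ (Witness.x k (![0, 0, 1, 2, 2, 3] i))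
            (Witness.x k (![0, 1, 1, 2, 3, 3] i)) with hP
      -- Basis indices 5, 6, 7 are the degree-two monomials, whose coordinates vanish by hypothesis;
      -- the first five remain.
      refine ⟨fun l => (Witness.basis k).repr P (Fin.castAdd 3 l), ?_⟩
      have h60 : (Witness.basis k).repr P 5 = 0 := h6 i 0
      have h61 : (Witness.basis k).repr P 6 = 0 := h6 i 1
      have h62 : (Witness.basis k).repr P 7 = 0 := h6 i 2
      have hsum := (Witness.basis k).sum_repr P
      rw [Fin.sum_univ_eight, h60, h61, h62, zero_smul, zero_smul, zero_smul, add_zero, add_zero,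
        add_zero] at hsum
      simp only [hb] at hsum
      exact hsum.symm
  refine LinearMap.ext fun x => LinearMap.ext fun y => ?_
  rw [(hprod x y).1, ← fstComponent_apply, key]
  rfl

theorem finrank_cocycles_le {k C V : Type*} [Field k] [CommRing C] [Algebra k C] [AddCommGroup V]
    [Module k V] [Module.Finite k V] (D : (C →ₗ[k] C →ₗ[k] C) →ₗ[k] V)
    (hD : ∀ φ ∈ cocycles k C, D φ = 0 → φ = 0) :
    Module.finrank k (cocycles k C) ≤ Module.finrank k V := by
  have hinj : Function.Injective (D ∘ₗ (cocycles k C).subtype) := fun φ ψ h => by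
    have h1 : D φ.1 = D ψ.1 := h
    have h2 := hD _ (add_mem φ.2 (Submodule.smul_mem _ (-1 : k) ψ.2))
      (by rw [map_add, map_smul, h1, neg_one_smul, add_neg_cancel])
    refine Subtype.ext (LinearMap.ext fun x => LinearMap.ext fun y => ?_)
    have h3 := LinearMap.congr_fun₂ h2 x y
    rw [LinearMap.add_apply, LinearMap.add_apply, LinearMap.smul_apply, LinearMap.smul_apply,
      neg_one_smul] at h3
    exact add_neg_eq_zero.1 h3
  exact LinearMap.finrank_le_finrank_of_injective hinj

theorem finrank_cocycles_lt :
    Module.finrank k (cocycles k (Witness k × (Fin m → k))) < (8 + m) ^ 2 := by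
  have : Module.Finite k (Witness k) := Module.Finite.of_basis (Witness.basis k)
  refine (finrank_cocycles_le (cocycleData k m) fun φ hφ =>
    eq_zero_of_cocycleData_eq_zero k m hφ).trans_lt ?_
  -- The count is `m * (8 + m) + (8 + m) + 7 * m + 4 * 8 + 6 * 3 = m ^ 2 + 16 * m + 58`, against `m
  -- ^ 2 + 16 * m + 64`.
  simp only [Module.finrank_prod, Module.finrank_pi_fintype, Module.finrank_self, Finset.sum_const,
    Finset.card_univ, Fintype.card_fin, Witness.finrank_eq, smul_eq_mul]
  nlinarith

end Bound

end BasedAlg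

/-! ### The main theorem -/

theorem mainTheorem7 (k : Type u) [Field k] (n : ℕ) (hn : 8 ≤ n) :
    -- the variety is reducible
    (Nonempty (BasedAlg.𝔅Over n k) ∧ ¬ IrreducibleSpace (BasedAlg.𝔅Over n k)) ∧
    -- the witness has rank 8, and its product with `n - 8` split factors has rank `n`
    Module.finrank k (BasedAlg.Witness k) = 8 ∧
    Nonempty (Module.Basis (Fin n) k (BasedAlg.Witness k × (Fin (n - 8) → k))) ∧
    -- in no basis is the product a degeneration of étale algebras
    ∀ b : Module.Basis (Fin n) k (BasedAlg.Witness k × (Fin (n - 8) → k)),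
      BasedAlg.point b ∉ closure (BasedAlg.etaleLocus n k : Set (BasedAlg.𝔅Over n k)) := by
  have h := BasedAlg.finrank_cocycles_lt k (n - 8)
  rw [Nat.add_sub_cancel' hn] at h
  have : Module.Finite k (BasedAlg.Witness k) := Module.Finite.of_basis (BasedAlg.Witness.basis k)
  have hdim : Module.finrank k (BasedAlg.Witness k × (Fin (n - 8) → k)) = n := by
    rw [Module.finrank_prod, BasedAlg.Witness.finrank_eq, Module.finrank_fin_fun]
    omega
  let b := Module.finBasisOfFinrankEq k (BasedAlg.Witness k × (Fin (n - 8) → k)) hdim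
  exact ⟨⟨⟨BasedAlg.point b⟩, BasedAlg.not_irreducibleSpace b h⟩, BasedAlg.Witness.finrank_eq k, ⟨b⟩,
    fun b => BasedAlg.point_notMem_closure b h⟩
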